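/- **Theorem 1.** Let $\mathbb R^{n_1}$, $\mathbb R^{n_2}$ be equipped with arbitrary norms, and for a square matrix $A$ let $\mu(A)=\limsup_{h\to0^+}\frac{\|I+hA\|-1}{h}$ be the matrix measure of the induced norm. For $i=1,2$ let $H_i:\mathbb R^{n_i}\to\mathbb R$ be a $C^1$ switching function with $\nabla H_i\neq0$ on the switching surface $\{H_i=0\}$, and let $f_{1i}(\xi_1,\xi_2,t)\in\mathbb R^{n_1}$, $f_{2i}(\xi_1,\xi_2,t)\in\mathbb R^{n_2}$ be continuously differentiable in $(\xi_1,\xi_2)$ for each $t\ge0$. Consider the feedback interconnection of two bimodal switched systems $$\dot\xi_1=\begin{cases}f_{11}(\xi_1,\xi_2,t)& H_1(\xi_1)>0\\ f_{12}(\xi_1,\xi_2,t)& H_1(\xi_1)<0\end{cases}\qquad \dot\xi_2=\begin{cases}f_{21}(\xi_1,\xi_2,t)& H_2(\xi_2)>0\\ f_{22}(\xi_1,\xi_2,t)& H_2(\xi_2)<0\end{cases}$$ with solutions in the sense of Filippov: absolutely continuous functions that satisfy the equations for almost every time, where on the surface $H_i(\xi_i)=0$ the right-hand side of system $i$ may be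 any convex combination of $f_{i1}$ and $f_{i2}$. Assume that there are positive constants $p_i,q_i,\tilde k_i,\tilde m_i$ ($i=1,2$) such that, for all $\xi_1,\xi_2$ and all $t\ge0$: 1. $\mu\big(\frac{\partial f_{1i}}{\partial\xi_1}\big)\le-p_i$ in the closed region of mode $i$ of system I ($H_1(\xi_1)\ge0$ for $i=1$, $H_1(\xi_1)\le0$ for $i=2$), and $\mu\big(\frac{\partial f_{2i}}{\partial\xi_2}\big)\le-q_i$ in the closed region of mode $i$ of system II ($H_2(\xi_2)\ge0$ for $i=1$, $H_2(\xi_2)\le0$ for $i=2$); 2. $\mu\big[(f_{i1}-f_{i2})\nabla H_i(\xi_i)\big]=0$ whenever $H_i(\xi_i)=0$, for $i=1,2$; 3. $\big\|\frac{\partial f_{1i}}{\partial\xi_2}\big\|\le\tilde k_i$ and $\big\|\frac{\partial f_{2i}}{\partial\xi_1}\big\|\le\tilde m_i$ in the same closed regions of mode $i$ of system I and of system II, respectively. Put $\tilde k=\max(\tilde k_1,\tilde k_2)$, $\tilde m=\max(\tilde m_1,\tilde m_2)$, $p=\min(p_1,p_2)$, $q=\min(q_1,q_2)$. If $$\frac{\tilde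 k\,\tilde m}{p\,q}<1,$$ then the interconnected system is exponentially incrementally stable: there are constants $K,c>0$ such that any two solutions $\xi=(\xi_1,\xi_2)$ and $\eta=(\eta_1,\eta_2)$ that start at the same time $t_0\ge0$ satisfy $\|\xi(t)-\eta(t)\|\le Ke^{-c(t-t_0)}\|\xi(t_0)-\eta(t_0)\|$ for all $t\ge t_0$ at which both exist, where $\|(\xi_1,\xi_2)\|=\max(\|\xi_1\|,\|\xi_2\|)$. -/

import Mathlib

open Set Filter Topology MeasureTheory

section GeneralNotions

variable {E : Type*} [NormedAddCommGroup E] [NormedSpace ℝ E]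

/-- The matrix measure (logarithmic norm) of a linear operator `A`, induced by the norm of `E`:
`limsup_{h → 0⁺} (‖I + h A‖ - 1) / h`, with the operator norm. -/
noncomputable def matrixMeasure (A : E →L[ℝ] E) : ℝ :=
  limsup (fun h : ℝ => (‖ContinuousLinearMap.id ℝ E + h • A‖ - 1) / h) (𝓝[>] 0)

/-- The Filippov set of a bimodal piecewise smooth vector field at a point where the switching
function takes the value `h` and the two modes take the values `v₁` and `v₂`: mode 1 is active
where the switching function is positive, mode 2 where it is negative, and all convex
combinations of the two modes are admitted on the switching surface. -/
noncomputable def filippovSet (h : ℝ) (v₁ v₂ : E) : Set E :=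
  if 0 < h then {v₁} else if h < 0 then {v₂} else segment ℝ v₁ v₂

/-- `x` is a (Carathéodory) solution on `[a, b]` of the differential inclusion `ẋ ∈ 𝓕 t x`:
it is absolutely continuous and satisfies the inclusion at almost every time. -/
def IsSolutionOn (𝓕 : ℝ → E → Set E) (a b : ℝ) (x : ℝ → E) : Prop :=
  AbsolutelyContinuousOnInterval x a b ∧
    ∀ᵐ t ∂(volume.restrict (Icc a b)), ∃ v ∈ 𝓕 t (x t), HasDerivAt x v t

/-- Uniform global exponential incremental stability of `ẋ ∈ 𝓕 t x`, `t ≥ 0`: any two solutions,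
with arbitrary initial states, started at the same time `t₀ ≥ 0`, approach each other
exponentially for as long as both of them exist, with constants that depend neither on the
solutions nor on the initial time. -/
def ExpIncrementallyStable (𝓕 : ℝ → E → Set E) : Prop :=
  ∃ K > 0, ∃ c > 0, ∀ t₀ t₁ : ℝ, 0 ≤ t₀ → t₀ ≤ t₁ → ∀ x y : ℝ → E,
    IsSolutionOn 𝓕 t₀ t₁ x → IsSolutionOn 𝓕 t₀ t₁ y →
      ∀ t ∈ Icc t₀ t₁, ‖x t - y t‖ ≤ K * Real.exp (-c * (t - t₀)) * ‖x t₀ - y t₀‖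

end GeneralNotions

section Interconnection

variable {E₁ E₂ : Type*} [NormedAddCommGroup E₁] [NormedSpace ℝ E₁]
  [NormedAddCommGroup E₂] [NormedSpace ℝ E₂]

/-- The feedback interconnection, in the sense of Filippov, of the bimodal switched systems
`ξ̇₁ = f₁ᵢ(ξ₁, ξ₂, t)` and `ξ̇₂ = f₂ᵢ(ξ₁, ξ₂, t)`, `i = 1, 2`, where the active mode of system I is
given by the sign of `H₁ ξ₁` and that of system II by the sign of `H₂ ξ₂`. -/
noncomputable def feedbackInclusion (H₁ : E₁ → ℝ) (H₂ : E₂ → ℝ)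
    (f₁₁ f₁₂ : E₁ → E₂ → ℝ → E₁) (f₂₁ f₂₂ : E₁ → E₂ → ℝ → E₂) :
    ℝ → E₁ × E₂ → Set (E₁ × E₂) :=
  fun t ξ =>
    filippovSet (H₁ ξ.1) (f₁₁ ξ.1 ξ.2 t) (f₁₂ ξ.1 ξ.2 t) ×ˢ
      filippovSet (H₂ ξ.2) (f₂₁ ξ.1 ξ.2 t) (f₂₂ ξ.1 ξ.2 t)

/-- `H` is a continuously differentiable switching function whose zero set is a regular
hypersurface. -/
def IsSwitchingFunction {E : Type*} [NormedAddCommGroup E] [NormedSpace ℝ E] (H : E → ℝ) : Prop :=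
  ContDiff ℝ 1 H ∧ ∀ z, H z = 0 → fderiv ℝ H z ≠ 0

/-- At every time `t ≥ 0` the vector field is continuously differentiable in the joint state. -/
def IsSmoothMode {E : Type*} [NormedAddCommGroup E] [NormedSpace ℝ E]
    (f : E₁ → E₂ → ℝ → E) : Prop :=
  ∀ t, 0 ≤ t → ContDiff ℝ 1 (fun ξ : E₁ × E₂ => f ξ.1 ξ.2 t)

/-- The Jacobian of `f` with respect to the first state. -/
noncomputable def jac₁ {E : Type*} [NormedAddCommGroup E] [NormedSpace ℝ E]
    (f : E₁ → E₂ → ℝ → E) (ξ₁ : E₁) (ξ₂ : E₂) (t : ℝ) : E₁ →L[ℝ] E :=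
  fderiv ℝ (fun z => f z ξ₂ t) ξ₁

/-- The Jacobian of `f` with respect to the second state. -/
noncomputable def jac₂ {E : Type*} [NormedAddCommGroup E] [NormedSpace ℝ E]
    (f : E₁ → E₂ → ℝ → E) (ξ₁ : E₁) (ξ₂ : E₂) (t : ℝ) : E₂ →L[ℝ] E :=
  fderiv ℝ (fun z => f ξ₁ z t) ξ₂

/-- The rank-one operator `v ∇H(z)`, i.e. `w ↦ (∇H(z) w) v`. -/
noncomputable def jumpGrad {E : Type*} [NormedAddCommGroup E] [NormedSpace ℝ E]
    (H : E → ℝ) (z v : E) : E →L[ℝ] E :=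
  (fderiv ℝ H z).smulRight v

end Interconnection

/-!
Let `ψ` be a functional norming `x - y`. Along the segment from `(y, v)` to `(x, u)` the bounds on
the matrix measures and on the input Jacobians say that each mode of `ψ ∘ f` has slope at most
`c = -p ‖x - y‖ + k ‖u - v‖` on its own closed region. The segment may meet the switching surface in
an arbitrary closed set, but the condition on the rank-one switching terms says that the jump of
`ψ ∘ f` is opposite in sign to the direction of crossing, so that the switched function can only
jump down along the segment and any two Filippov velocities satisfy `ψ (a - b) ≤ c`. The argument
leaves out the case where `x` lies on the surface and the segment arrives tangentially; the same
condition then provides a norming functional that vanishes on the jump.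

As the derivative of the norm of a curve is the value of any norming functional on its velocity, the
distances `r` and `s` of the two states satisfy `r' ≤ -p r + k s` and `s' ≤ -q s + m r`, and by the
small-gain condition some weighted sum `r + β s` decays exponentially.
-/

section Norming

variable {E : Type*} [NormedAddCommGroup E] [NormedSpace ℝ E]

/-- `ψ` is a norming functional for `w`: a subgradient at `w` of the norm. -/
def IsNorming (ψ : E →L[ℝ] ℝ) (w : E) : Prop :=
  ‖ψ‖ ≤ 1 ∧ ψ w = ‖w‖

namespace IsNorming

variable {ψ : E →L[ℝ] ℝ} {w : E}

theorem apply_le (hψ : IsNorming ψ w) (x : E) : ψ x ≤ ‖x‖ := by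
  simpa using (le_abs_self _).trans (ψ.le_of_opNorm_le hψ.1 x)

theorem apply_le_norm_id_add_smul (hψ : IsNorming ψ w) (A : E →L[ℝ] E) {r : ℝ} (hr : 0 < r) :
    ψ (A w) ≤ (‖ContinuousLinearMap.id ℝ E + r • A‖ - 1) / r * ‖w‖ := by
  have hle : ‖w‖ + r * ψ (A w) ≤ ‖ContinuousLinearMap.id ℝ E + r • A‖ * ‖w‖ := by
    simpa [hψ.2] using (hψ.apply_le _).trans ((ContinuousLinearMap.id ℝ E + r • A).le_opNorm w)
  rw [div_mul_eq_mul_div, le_div_iff₀ hr]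
  linarith

end IsNorming

theorem isBoundedUnder_norm_id_add_smul (A : E →L[ℝ] E) :
    IsBoundedUnder (· ≤ ·) (𝓝[>] (0 : ℝ))
      fun r => (‖ContinuousLinearMap.id ℝ E + r • A‖ - 1) / r := by
  refine isBoundedUnder_of_eventually_le (a := ‖A‖) ?_
  filter_upwards [self_mem_nhdsWithin] with r (hr : 0 < r)
  rw [div_le_iff₀ hr]
  calc ‖ContinuousLinearMap.id ℝ E + r • A‖ - 1
      ≤ ‖ContinuousLinearMap.id ℝ E‖ + ‖r • A‖ - 1 := by gcongr; exact norm_add_le _ _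
    _ ≤ 1 + ‖r • A‖ - 1 := by gcongr; exact ContinuousLinearMap.norm_id_le
    _ = ‖A‖ * r := by rw [norm_smul, Real.norm_of_nonneg hr.le]; ring

theorem IsNorming.apply_le_of_matrixMeasure_le {ψ : E →L[ℝ] ℝ} {w : E} (hψ : IsNorming ψ w)
    {A : E →L[ℝ] E} {c : ℝ} (hA : matrixMeasure A ≤ c) : ψ (A w) ≤ c * ‖w‖ := by
  have hlt : ∀ C, c < C → ψ (A w) ≤ C * ‖w‖ := fun C hC => by
    obtain ⟨r, hrC, hr⟩ := ((eventually_lt_of_limsup_lt (hA.trans_lt hC)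
      (isBoundedUnder_norm_id_add_smul A)).and self_mem_nhdsWithin).exists
    exact (hψ.apply_le_norm_id_add_smul A hr).trans (by gcongr)
  have hlim : Tendsto (fun C => C * ‖w‖) (𝓝[>] c) (𝓝 (c * ‖w‖)) :=
    (tendsto_id.mul_const _).mono_left nhdsWithin_le_nhds
  exact ge_of_tendsto hlim (eventually_mem_nhdsWithin.mono hlt)

theorem exists_isNorming_apply_eq_zero {w d : E} (h : ∀ s : ℝ, ‖w‖ ≤ ‖w + s • d‖) :
    ∃ ψ, IsNorming ψ w ∧ ψ d = 0 := by
  let π := (ℝ ∙ d).mkQL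
  have hπ : ‖π w‖ = ‖w‖ := by
    refine le_antisymm (Submodule.Quotient.norm_mk_le _ w) (le_of_forall_pos_lt_add fun ε hε => ?_)
    obtain ⟨x, hx, hlt⟩ := Submodule.Quotient.norm_mk_lt (S := ℝ ∙ d) (π w) hε
    obtain ⟨s, hs⟩ := Submodule.mem_span_singleton.1 ((Submodule.Quotient.eq _).1 hx)
    calc ‖w‖ ≤ ‖w + s • d‖ := h s
      _ = ‖x‖ := by rw [hs, add_sub_cancel]
      _ < ‖π w‖ + ε := hlt
  have hπ_le : ‖π‖ ≤ 1 :=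
    π.opNorm_le_bound zero_le_one fun x => by
      rw [one_mul]
      exact Submodule.Quotient.norm_mk_le _ x
  have hπd : π d = 0 := (Submodule.Quotient.mk_eq_zero _).2 (Submodule.mem_span_singleton_self d)
  obtain ⟨φ, hφ, hφw⟩ := exists_dual_vector'' ℝ (π w)
  refine ⟨φ ∘L π, ⟨?_, ?_⟩, ?_⟩
  · exact (φ.opNorm_comp_le π).trans (mul_le_one₀ hφ (norm_nonneg _) hπ_le)
  · simpa [hπ] using hφw
  · simp [hπd]

theorem exists_apply_eq_one_of_ne_zero {L : E →L[ℝ] ℝ} (hL : L ≠ 0) : ∃ n, L n = 1 := by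
  obtain ⟨x, hx⟩ := ContinuousLinearMap.exists_ne_zero hL
  exact ⟨(L x)⁻¹ • x, by simp [hx]⟩

theorem exists_isNorming_apply_eq_zero_of_mul_nonpos {L : E →L[ℝ] ℝ} (hL : L ≠ 0) {d : E}
    (h : ∀ w ψ, IsNorming ψ w → L w * ψ d ≤ 0) {w : E} (hw : L w = 0) :
    ∃ ψ, IsNorming ψ w ∧ ψ d = 0 := by
  refine exists_isNorming_apply_eq_zero fun s => ?_
  obtain ⟨n, hn⟩ := exists_apply_eq_one_of_ne_zero hL
  -- Moving `w` off the kernel of `L`, to the side given by `-s`, fixes the sign of `s * ψ d`.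
  have hpos : ∀ r > 0, ‖w - (r * s) • n‖ ≤ ‖w - (r * s) • n + s • d‖ := fun r hr => by
    obtain ⟨ψ, hψ, hψw⟩ := exists_dual_vector'' ℝ (w - (r * s) • n)
    have hψ' : IsNorming ψ (w - (r * s) • n) := ⟨hψ, hψw⟩
    have hsψ : 0 ≤ r * (s * ψ d) := by
      simpa [hw, hn, mul_assoc] using h _ ψ hψ'
    have hadd := hψ'.apply_le (w - (r * s) • n + s • d)
    rw [map_add, hψ'.2, map_smul, smul_eq_mul] at hadd
    linarith [nonneg_of_mul_nonneg_right hsψ hr]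
  have hlim : Tendsto (fun r : ℝ => ‖w - (r * s) • n + s • d‖ - ‖w - (r * s) • n‖) (𝓝[>] 0)
      (𝓝 (‖w + s • d‖ - ‖w‖)) := by
    refine (Continuous.tendsto' ?_ _ _ (by simp)).mono_left nhdsWithin_le_nhds
    fun_prop
  exact sub_nonneg.1 (ge_of_tendsto hlim
    (eventually_mem_nhdsWithin.mono fun r hr => sub_nonneg.2 (hpos r hr)))

end Norming

section OneSided

theorem le_add_mul_sub_of_eventually_nhdsGT {g : ℝ → ℝ} {c : ℝ}
    (hright : ∀ s, ∀ C > c, ∀ᶠ t in 𝓝[>] 0, g (s + t) ≤ g s + C * t)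
    (hleft : ∀ s, ∀ C > c, ∀ᶠ t in 𝓝[>] 0, g s ≤ g (s - t) + C * t)
    {a b : ℝ} (hab : a ≤ b) : g b ≤ g a + c * (b - a) := by
  suffices hC : ∀ C > c, g b ≤ g a + C * (b - a) by
    have hlim : Tendsto (fun C => g a + C * (b - a)) (𝓝[>] c) (𝓝 (g a + c * (b - a))) :=
      (Continuous.tendsto (by fun_prop) c).mono_left nhdsWithin_le_nhds
    exact ge_of_tendsto hlim (eventually_mem_nhdsWithin.mono hC)
  intro C hC
  let S := {s ∈ Icc a b | g s ≤ g a + C * (s - a)}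
  have haS : a ∈ S := ⟨left_mem_Icc.2 hab, by simp⟩
  have hbdd : BddAbove S := ⟨b, fun s hs => hs.1.2⟩
  have hsup : sSup S ∈ Icc a b := ⟨le_csSup hbdd haS, csSup_le ⟨a, haS⟩ fun s hs => hs.1.2⟩
  have hmem : sSup S ∈ S := by
    refine ⟨hsup, ?_⟩
    obtain ⟨ε, hε, hεC⟩ := mem_nhdsGT_iff_exists_Ioo_subset.1 (hleft (sSup S) C hC)
    obtain ⟨s, hs, hlt⟩ := exists_lt_of_lt_csSup ⟨a, haS⟩ (sub_lt_self (sSup S) hε)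
    rcases (le_csSup hbdd hs).eq_or_lt with heq | hs_lt
    · exact heq ▸ hs.2
    · have hgs := hεC (show sSup S - s ∈ Ioo 0 ε from ⟨by linarith, by linarith⟩)
      rw [mem_ofPred_eq, sub_sub_cancel] at hgs
      linarith [hs.2]
  rcases hsup.2.eq_or_lt with heq | hlt
  · exact heq ▸ hmem.2
  obtain ⟨t, hgt, ht⟩ :=
    ((hright (sSup S) C hC).and (Ioo_mem_nhdsGT (sub_pos.2 hlt))).exists
  have htS : sSup S + t ∈ S :=
    ⟨⟨by linarith [hsup.1, ht.1], by linarith [ht.2]⟩, by linarith [hmem.2]⟩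
  linarith [le_csSup hbdd htS, ht.1]

variable {Z : Type*} [NormedAddCommGroup Z] [NormedSpace ℝ Z] {f : Z → ℝ} {z : Z}

theorem tendsto_add_smul_nhdsGT (z ζ : Z) :
    Tendsto (fun s : ℝ => z + s • ζ) (𝓝[>] 0) (𝓝 z) :=
  (Continuous.tendsto' (by fun_prop) _ _ (by simp)).mono_left nhdsWithin_le_nhds

theorem hasDerivAt_comp_add_smul {s : ℝ} {ζ : Z} (hf : DifferentiableAt ℝ f (z + s • ζ)) :
    HasDerivAt (fun s : ℝ => f (z + s • ζ)) (fderiv ℝ f (z + s • ζ) ζ) s := by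
  have hline : HasDerivAt (fun s : ℝ => z + s • ζ) ζ s := by
    simpa using ((hasDerivAt_id s).smul_const ζ).const_add z
  exact hf.hasFDerivAt.comp_hasDerivAt s hline

theorem eventually_apply_add_smul_le (hf : DifferentiableAt ℝ f z) {ζ : Z} {C : ℝ}
    (hC : fderiv ℝ f z ζ < C) : ∀ᶠ s : ℝ in 𝓝[>] 0, f (z + s • ζ) ≤ f z + C * s := by
  have hd : HasDerivAt (fun s : ℝ => f (z + s • ζ)) (fderiv ℝ f z ζ) 0 := by
    simpa using hasDerivAt_comp_add_smul (f := f) (z := z) (ζ := ζ) (s := 0) (by simpa using hf)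
  filter_upwards [hd.hasDerivWithinAt.limsup_slope_le' self_notMem_Ioi hC, self_mem_nhdsWithin]
    with s hs (hs0 : 0 < s)
  rw [slope_def_field, sub_zero, zero_smul, add_zero, div_lt_iff₀ hs0] at hs
  linarith

theorem eventually_apply_add_smul_neg (hf : DifferentiableAt ℝ f z) {ζ : Z} (hz : f z = 0)
    (hζ : fderiv ℝ f z ζ < 0) : ∀ᶠ s : ℝ in 𝓝[>] 0, f (z + s • ζ) < 0 := by
  filter_upwards [eventually_apply_add_smul_le hf (ζ := ζ) (C := fderiv ℝ f z ζ / 2) (by linarith),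
    self_mem_nhdsWithin] with s hs (hs0 : 0 < s)
  nlinarith

theorem apply_add_smul_nonpos_of_fderiv_neg (hf : Differentiable ℝ f) {ζ : Z} (hz : f z ≤ 0)
    {T : ℝ} (hT : 0 ≤ T) (h : ∀ s ∈ Ico 0 T, f (z + s • ζ) = 0 → fderiv ℝ f (z + s • ζ) ζ < 0) :
    f (z + T • ζ) ≤ 0 := by
  have hd : ∀ s : ℝ, HasDerivAt (fun s : ℝ => f (z + s • ζ)) (fderiv ℝ f (z + s • ζ) ζ) s :=
    fun s => hasDerivAt_comp_add_smul (hf _)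
  exact image_le_of_deriv_right_lt_deriv_boundary' (B := 0) (B' := 0)
    (fun s _ => (hd s).continuousAt.continuousWithinAt) (fun s _ => (hd s).hasDerivWithinAt)
    (by simpa using hz) continuousOn_const (fun s _ => hasDerivWithinAt_const ..) h
    (right_mem_Icc.2 hT)

theorem eventually_apply_add_smul_nonpos (hf : ContDiff ℝ 1 f) {ζ : Z} (hz : f z = 0)
    (hdf : fderiv ℝ f z ≠ 0) (h : ∀ᶠ x in 𝓝 z, f x = 0 → fderiv ℝ f x ζ ≤ 0) :
    ∀ᶠ s : ℝ in 𝓝[>] 0, f (z + s • ζ) ≤ 0 := by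
  -- Tilted to `ζ - ε • n`, with `n` transversal to the surface, the direction points strictly
  -- into `{f ≤ 0}` along the surface near `z`; then `ε → 0`.
  obtain ⟨n, hn⟩ := exists_apply_eq_one_of_ne_zero hdf
  have hdn : ∀ᶠ x in 𝓝 z, 0 < fderiv ℝ f x n :=
    ((hf.continuous_fderiv one_ne_zero).clm_apply continuous_const).continuousAt.eventually
      (lt_mem_nhds (by simp [hn]))
  have hjoint : Tendsto (fun r : ℝ × ℝ => z + r.1 • (ζ - r.2 • n)) (𝓝 (0, 0)) (𝓝 z) :=
    Continuous.tendsto' (by fun_prop) _ _ (by simp)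
  obtain ⟨δ, hδ, hball⟩ := Metric.eventually_nhds_iff_ball.1 (hjoint.eventually (h.and hdn))
  have htilt : ∀ s ∈ Ioo 0 δ, ∀ ε ∈ Ioo 0 δ, f (z + s • (ζ - ε • n)) ≤ 0 := by
    intro s hs ε hε
    refine apply_add_smul_nonpos_of_fderiv_neg (hf.differentiable one_ne_zero) hz.le hs.1.le
      fun r hr hr0 => ?_
    have hmem : (r, ε) ∈ Metric.ball ((0, 0) : ℝ × ℝ) δ := by
      rw [Metric.mem_ball, Prod.dist_eq, Real.dist_0_eq_abs, Real.dist_0_eq_abs,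
        abs_of_nonneg hr.1, abs_of_pos hε.1]
      exact max_lt (hr.2.trans hs.2) hε.2
    obtain ⟨hζ, hn_pos⟩ := hball _ hmem
    rw [map_sub, map_smul, smul_eq_mul]
    linarith [hζ hr0, mul_pos hε.1 hn_pos]
  filter_upwards [Ioo_mem_nhdsGT hδ] with s hs
  have hlim : Tendsto (fun ε : ℝ => f (z + s • (ζ - ε • n))) (𝓝[>] 0) (𝓝 (f (z + s • ζ))) :=
    (hf.continuous.comp (by fun_prop)).tendsto' _ _ (by simp) |>.mono_left nhdsWithin_le_nhds
  exact le_of_tendsto hlim (eventually_of_mem (Ioo_mem_nhdsGT hδ) (htilt s hs))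

end OneSided

section Filippov

variable {E : Type*} [NormedAddCommGroup E] [NormedSpace ℝ E] {h : ℝ} {v₁ v₂ v : E}

theorem filippovSet_subset {s : Set E} (hs : Convex ℝ s) (h₁ : 0 ≤ h → v₁ ∈ s)
    (h₂ : h ≤ 0 → v₂ ∈ s) : filippovSet h v₁ v₂ ⊆ s := by
  rcases lt_trichotomy h 0 with hneg | rfl | hpos
  · simpa [filippovSet, hneg, hneg.not_gt] using h₂ hneg.le
  · simpa [filippovSet] using hs.segment_subset (h₁ le_rfl) (h₂ le_rfl)
  · simpa [filippovSet, hpos] using h₁ hpos.le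

theorem filippovSet_neg (h : ℝ) (v₁ v₂ : E) : filippovSet (-h) v₂ v₁ = filippovSet h v₁ v₂ := by
  rcases lt_trichotomy h 0 with hneg | rfl | hpos
  · simp [filippovSet, hneg, hneg.not_gt]
  · simp [filippovSet, segment_symm ℝ v₂ v₁]
  · simp [filippovSet, hpos, hpos.not_gt]

theorem map_mem_filippovSet (hv : v ∈ filippovSet h v₁ v₂) (ψ : E →L[ℝ] ℝ) :
    ψ v ∈ filippovSet h (ψ v₁) (ψ v₂) := by
  rcases lt_trichotomy h 0 with hneg | rfl | hpos
  · simp_all [filippovSet, hneg.not_gt]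
  · simp only [filippovSet, lt_self_iff_false, if_false] at hv ⊢
    exact image_segment ℝ ψ.toLinearMap.toAffineMap v₁ v₂ ▸ mem_image_of_mem ψ hv
  · simp_all [filippovSet]

end Filippov

section SwitchedValue

variable {Z : Type*}

/-- The value of the switched function with modes `α` and `β`; on the switching surface it is that
of `β`. -/
noncomputable def switchedValue (η α β : Z → ℝ) (z : Z) : ℝ :=
  if 0 < η z then α z else β z

theorem switchedValue_of_pos {η : Z → ℝ} (α β : Z → ℝ) {z : Z} (hz : 0 < η z) :
    switchedValue η α β z = α z :=
  if_pos hz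

theorem switchedValue_of_nonpos {η : Z → ℝ} (α β : Z → ℝ) {z : Z} (hz : η z ≤ 0) :
    switchedValue η α β z = β z :=
  if_neg hz.not_gt

theorem switchedValue_neg (η α β : Z → ℝ) (z : Z) :
    switchedValue η (-α) (-β) z = -switchedValue η α β z := by
  simp only [switchedValue, Pi.neg_apply]
  split_ifs <;> rfl

end SwitchedValue

section PiecewiseSlope

variable {Z : Type*} [NormedAddCommGroup Z] [NormedSpace ℝ Z]

/-- The switched function with modes `α` on `{0 ≤ η}` and `β` on `{η ≤ 0}` has slope at most `c`
in the direction `ζ`: each mode does on its closed region, and the jump across the surface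
`{η = 0}` met when moving along `ζ` is downwards. -/
structure HasPiecewiseSlopeLE (η α β : Z → ℝ) (ζ : Z) (c : ℝ) : Prop where
  switching : IsSwitchingFunction η
  differentiable₁ : Differentiable ℝ α
  differentiable₂ : Differentiable ℝ β
  slope₁ : ∀ z, 0 ≤ η z → fderiv ℝ α z ζ ≤ c
  slope₂ : ∀ z, η z ≤ 0 → fderiv ℝ β z ζ ≤ c
  jump : ∀ z, η z = 0 → fderiv ℝ η z ζ * (α z - β z) ≤ 0

theorem IsSwitchingFunction.neg {η : Z → ℝ} (hη : IsSwitchingFunction η) :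
    IsSwitchingFunction (-η) :=
  ⟨hη.1.neg, fun z hz => by simpa [fderiv_neg] using hη.2 z (by simpa using hz)⟩

namespace HasPiecewiseSlopeLE

variable {η α β : Z → ℝ} {ζ : Z} {c : ℝ}

theorem symm (h : HasPiecewiseSlopeLE η α β ζ c) : HasPiecewiseSlopeLE (-η) β α ζ c where
  switching := h.switching.neg
  differentiable₁ := h.differentiable₂
  differentiable₂ := h.differentiable₁
  slope₁ z hz := h.slope₂ z (by simpa using hz)
  slope₂ z hz := h.slope₁ z (by simpa using hz)
  jump z hz := by
    have hjump := h.jump z (by simpa using hz)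
    rw [fderiv_neg, neg_apply]
    linarith

theorem reverse (h : HasPiecewiseSlopeLE η α β ζ c) :
    HasPiecewiseSlopeLE η (-α) (-β) (-ζ) c where
  switching := h.switching
  differentiable₁ := h.differentiable₁.neg
  differentiable₂ := h.differentiable₂.neg
  slope₁ z hz := by simpa [fderiv_neg] using h.slope₁ z hz
  slope₂ z hz := by simpa [fderiv_neg] using h.slope₂ z hz
  jump z hz := by
    have hjump := h.jump z hz
    rw [map_neg, Pi.neg_apply, Pi.neg_apply]
    linarith

theorem eventually_switching_nonpos (h : HasPiecewiseSlopeLE η α β ζ c) {z : Z} (hz : η z = 0)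
    (hlt : β z < α z) : ∀ᶠ s : ℝ in 𝓝[>] 0, η (z + s • ζ) ≤ 0 := by
  have hnear : ∀ᶠ x in 𝓝 z, β x < α x :=
    h.differentiable₂.continuous.continuousAt.eventually_lt
      h.differentiable₁.continuous.continuousAt hlt
  exact eventually_apply_add_smul_nonpos h.switching.1 hz (h.switching.2 z hz)
    (hnear.mono fun x hx hx0 => nonpos_of_mul_nonpos_left (h.jump x hx0) (sub_pos.2 hx))

theorem eventually_switchedValue_add_smul_le (h : HasPiecewiseSlopeLE η α β ζ c) (z : Z) {C : ℝ}
    (hC : c < C) :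
    ∀ᶠ s : ℝ in 𝓝[>] 0, switchedValue η α β (z + s • ζ) ≤ switchedValue η α β z + C * s := by
  have hα : 0 ≤ η z → ∀ᶠ s : ℝ in 𝓝[>] 0, α (z + s • ζ) ≤ α z + C * s := fun hz =>
    eventually_apply_add_smul_le (h.differentiable₁ z) ((h.slope₁ z hz).trans_lt hC)
  have hβ : η z ≤ 0 → ∀ᶠ s : ℝ in 𝓝[>] 0, β (z + s • ζ) ≤ β z + C * s := fun hz =>
    eventually_apply_add_smul_le (h.differentiable₂ z) ((h.slope₂ z hz).trans_lt hC)
  have hη : Tendsto (fun s : ℝ => η (z + s • ζ)) (𝓝[>] 0) (𝓝 (η z)) :=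
    (h.switching.1.continuous.tendsto z).comp (tendsto_add_smul_nhdsGT z ζ)
  rcases lt_trichotomy (η z) 0 with hneg | hz | hpos
  · filter_upwards [hη.eventually_lt_const hneg, hβ hneg.le] with s hs hle
    rwa [switchedValue_of_nonpos _ _ hs.le, switchedValue_of_nonpos _ _ hneg.le]
  · rw [switchedValue_of_nonpos _ _ hz.le]
    by_cases hlt : β z < α z
    · filter_upwards [h.eventually_switching_nonpos hz hlt, hβ hz.le] with s hs hle
      rwa [switchedValue_of_nonpos _ _ hs]
    · filter_upwards [hα hz.ge, hβ hz.le] with s hαs hβs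
      rw [switchedValue]
      split_ifs <;> linarith
  · filter_upwards [hη.eventually_const_lt hpos, hα hpos.le] with s hs hle
    rwa [switchedValue_of_pos _ _ hs, switchedValue_of_pos _ _ hpos]

theorem switchedValue_add_smul_le (h : HasPiecewiseSlopeLE η α β ζ c) (z : Z) {b : ℝ}
    (hb : 0 ≤ b) : switchedValue η α β (z + b • ζ) ≤ switchedValue η α β z + c * b := by
  refine (le_add_mul_sub_of_eventually_nhdsGT (g := fun s => switchedValue η α β (z + s • ζ))
    (c := c) (fun s C hC => ?_) (fun s C hC => ?_) hb).trans_eq (by simp)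
  · simpa only [add_smul, ← add_assoc] using
      h.eventually_switchedValue_add_smul_le (z + s • ζ) hC
  · filter_upwards [h.reverse.eventually_switchedValue_add_smul_le (z + s • ζ) hC] with t ht
    rw [switchedValue_neg, switchedValue_neg, smul_neg, ← sub_eq_add_neg, add_sub_assoc,
      ← sub_smul] at ht
    linarith

theorem mode₁_le_switchedValue_add (h : HasPiecewiseSlopeLE η α β ζ c) {z : Z}
    (htan : η (z + ζ) = 0 → fderiv ℝ η (z + ζ) ζ = 0 → α (z + ζ) = β (z + ζ))
    (hz : 0 ≤ η (z + ζ)) : α (z + ζ) ≤ switchedValue η α β z + c := by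
  have hend : switchedValue η α β (z + ζ) ≤ switchedValue η α β z + c := by
    simpa using h.switchedValue_add_smul_le z zero_le_one
  rcases hz.eq_or_lt with hz0 | hpos
  · rw [switchedValue_of_nonpos _ _ hz0.ge] at hend
    rcases le_or_gt (α (z + ζ)) (β (z + ζ)) with hle | hlt
    · exact hle.trans hend
    -- The endpoint is then reached from the region `{0 < η}`, where the switched value is `α`.
    have hneg : fderiv ℝ η (z + ζ) ζ < 0 :=
      (nonpos_of_mul_nonpos_left (h.jump _ hz0.symm) (sub_pos.2 hlt)).lt_of_ne
        fun h0 => hlt.ne' (htan hz0.symm h0)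
    have hback : ∀ᶠ t : ℝ in 𝓝[>] 0, -η (z + ζ + t • -ζ) < 0 :=
      eventually_apply_add_smul_neg (f := -η)
        (h.switching.neg.1.differentiable one_ne_zero _) (by simp [← hz0])
        (by simpa [fderiv_neg] using hneg)
    have hαlim : Tendsto (fun t : ℝ => α (z + ζ + t • -ζ)) (𝓝[>] 0) (𝓝 (α (z + ζ))) :=
      (h.differentiable₁.continuous.tendsto _).comp (tendsto_add_smul_nhdsGT _ _)
    have hlim : Tendsto (fun t : ℝ => switchedValue η α β z + c * (1 - t)) (𝓝[>] 0)
        (𝓝 (switchedValue η α β z + c)) :=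
      (Continuous.tendsto' (by fun_prop) _ _ (by simp)).mono_left nhdsWithin_le_nhds
    refine le_of_tendsto_of_tendsto hαlim hlim ?_
    filter_upwards [hback, Ioo_mem_nhdsGT zero_lt_one] with t ht ht01
    have hle := h.switchedValue_add_smul_le z (sub_nonneg.2 ht01.2.le)
    rwa [show z + (1 - t) • ζ = z + ζ + t • -ζ by module,
      switchedValue_of_pos _ _ (neg_lt_zero.1 ht)] at hle
  · rwa [switchedValue_of_pos _ _ hpos] at hend

theorem le_switchedValue_add (h : HasPiecewiseSlopeLE η α β ζ c) {z : Z}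
    (htan : η (z + ζ) = 0 → fderiv ℝ η (z + ζ) ζ = 0 → α (z + ζ) = β (z + ζ)) {a : ℝ}
    (ha : a ∈ filippovSet (η (z + ζ)) (α (z + ζ)) (β (z + ζ))) :
    a ≤ switchedValue η α β z + c := by
  refine filippovSet_subset (convex_Iic _) (h.mode₁_le_switchedValue_add htan) (fun hz => ?_) ha
  simpa [switchedValue_of_nonpos _ _ hz] using h.switchedValue_add_smul_le z zero_le_one

theorem le_add_of_mem_filippovSet (h : HasPiecewiseSlopeLE η α β ζ c) {z : Z}
    (htan : η (z + ζ) = 0 → fderiv ℝ η (z + ζ) ζ = 0 → α (z + ζ) = β (z + ζ)) {a b : ℝ}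
    (ha : a ∈ filippovSet (η (z + ζ)) (α (z + ζ)) (β (z + ζ)))
    (hb : b ∈ filippovSet (η z) (α z) (β z)) : a ≤ b + c := by
  rw [← sub_le_iff_le_add]
  refine filippovSet_subset (convex_Ici (a - c)) (fun hz => ?_) (fun hz => ?_) hb
  · have hle := h.symm.le_switchedValue_add (z := z) (a := a)
      (by simpa [fderiv_neg, eq_comm (a := β (z + ζ))] using htan)
      (by simpa [filippovSet_neg] using ha)
    rwa [switchedValue_of_nonpos _ _ (by simpa using hz), ← sub_le_iff_le_add] at hle
  · have hle := h.le_switchedValue_add htan ha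
    rwa [switchedValue_of_nonpos _ _ hz, ← sub_le_iff_le_add] at hle

end HasPiecewiseSlopeLE

end PiecewiseSlope

section JumpGrad

variable {E : Type*} [NormedAddCommGroup E] [NormedSpace ℝ E]

theorem IsNorming.mul_apply_nonpos_of_matrixMeasure_jumpGrad_le {H : E → ℝ} {x d w : E}
    {ψ : E →L[ℝ] ℝ} (hψ : IsNorming ψ w) (hχ : matrixMeasure (jumpGrad H x d) ≤ 0) :
    fderiv ℝ H x w * ψ d ≤ 0 := by
  simpa [jumpGrad] using hψ.apply_le_of_matrixMeasure_le hχ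

theorem exists_isNorming_apply_eq_zero_of_tangent {H : E → ℝ} {x d : E}
    (hH : H x = 0 → fderiv ℝ H x ≠ 0) (hχ : H x = 0 → matrixMeasure (jumpGrad H x d) ≤ 0) (w : E) :
    ∃ ψ, IsNorming ψ w ∧ (H x = 0 → fderiv ℝ H x w = 0 → ψ d = 0) := by
  by_cases htan : H x = 0 ∧ fderiv ℝ H x w = 0
  · obtain ⟨ψ, hψ, hψd⟩ := exists_isNorming_apply_eq_zero_of_mul_nonpos (hH htan.1)
      (fun _ _ hψ => hψ.mul_apply_nonpos_of_matrixMeasure_jumpGrad_le (hχ htan.1)) htan.2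
    exact ⟨ψ, hψ, fun _ _ => hψd⟩
  · obtain ⟨ψ, hψ⟩ := exists_dual_vector'' ℝ w
    exact ⟨ψ, hψ, fun hx hw => absurd ⟨hx, hw⟩ htan⟩

end JumpGrad

section Dissipativity

variable {E F : Type*} [NormedAddCommGroup E] [NormedSpace ℝ E] [SeminormedAddCommGroup F]

/-- The inclusion `ẋ ∈ 𝓕 x u` with state `x` and input `u` is incrementally dissipative with
rate `p` and input gain `k`: the velocities at any two points satisfy, in the direction of some
norming functional of the difference of the states, the inequality `ṙ ≤ -p r + k ‖u - v‖` for the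
distance `r` of the states. -/
def IsDissipative (𝓕 : E → F → Set E) (p k : ℝ) : Prop :=
  ∀ x y u v, ∃ ψ, IsNorming ψ (x - y) ∧
    ∀ a ∈ 𝓕 x u, ∀ b ∈ 𝓕 y v, ψ (a - b) ≤ -p * ‖x - y‖ + k * ‖u - v‖

theorem IsDissipative.deriv_norm_sub_le {𝓕 : E → F → Set E} {p k : ℝ} (h : IsDissipative 𝓕 p k)
    {x y : ℝ → E} {a b : E} {u v : F} {t : ℝ} (hx : HasDerivAt x a t) (ha : a ∈ 𝓕 (x t) u)
    (hy : HasDerivAt y b t) (hb : b ∈ 𝓕 (y t) v)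
    (hn : DifferentiableAt ℝ (fun s => ‖x s - y s‖) t) :
    deriv (fun s => ‖x s - y s‖) t ≤ -p * ‖x t - y t‖ + k * ‖u - v‖ := by
  obtain ⟨ψ, hψ, hle⟩ := h (x t) (y t) u v
  -- `‖x - y‖ - ψ (x - y)` is nonnegative and vanishes at `t`.
  have hmin : IsLocalMin (fun s => ‖x s - y s‖ - ψ (x s - y s)) t :=
    Eventually.of_forall fun s => by
      simpa only [hψ.2, sub_self] using sub_nonneg.2 (hψ.apply_le (x s - y s))
  have hderiv := hmin.hasDerivAt_eq_zero
    (hn.hasDerivAt.sub (ψ.hasFDerivAt.comp_hasDerivAt t (hx.sub hy)))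
  rw [sub_eq_zero.1 hderiv]
  exact hle a ha b hb

end Dissipativity

section SwitchedField

variable {E F G : Type*} [NormedAddCommGroup E] [NormedSpace ℝ E]
  [NormedAddCommGroup F] [NormedSpace ℝ F] [NormedAddCommGroup G] [NormedSpace ℝ G]

theorem fderiv_prod_apply_eq_add {f : E → F → G} {x : E} {u : F}
    (hf : DifferentiableAt ℝ (fun z : E × F => f z.1 z.2) (x, u)) (w : E) (v : F) :
    fderiv ℝ (fun z : E × F => f z.1 z.2) (x, u) (w, v) =
      fderiv ℝ (fun z => f z u) x w + fderiv ℝ (f x) u v := by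
  have hfst : HasFDerivAt (fun z => f z u) _ x :=
    hf.hasFDerivAt.comp (f := fun z => (z, u)) x (hasFDerivAt_prodMk_left x u)
  have hsnd : HasFDerivAt (f x) _ u :=
    hf.hasFDerivAt.comp u (hasFDerivAt_prodMk_right x u)
  rw [hfst.fderiv, hsnd.fderiv]
  simp [← map_add]

theorem IsNorming.fderiv_comp_apply_le {f : E → F → E} {x w : E} {u : F} {ψ : E →L[ℝ] ℝ}
    (hψ : IsNorming ψ w) (hf : DifferentiableAt ℝ (fun z : E × F => f z.1 z.2) (x, u)) {c k : ℝ}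
    (hμ : matrixMeasure (fderiv ℝ (fun z => f z u) x) ≤ c) (hk : ‖fderiv ℝ (f x) u‖ ≤ k) (v : F) :
    fderiv ℝ (fun z : E × F => ψ (f z.1 z.2)) (x, u) (w, v) ≤ c * ‖w‖ + k * ‖v‖ := by
  have hψf : HasFDerivAt (fun z : E × F => ψ (f z.1 z.2)) _ (x, u) :=
    ψ.hasFDerivAt.comp (x, u) hf.hasFDerivAt
  rw [hψf.fderiv, ContinuousLinearMap.comp_apply,
    fderiv_prod_apply_eq_add hf, map_add]
  exact add_le_add (hψ.apply_le_of_matrixMeasure_le hμ)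
    ((hψ.apply_le _).trans (ContinuousLinearMap.le_of_opNorm_le _ hk v))

theorem fderiv_comp_fst_apply {H : E → ℝ} {z : E × F} (hH : DifferentiableAt ℝ H z.1)
    (ζ : E × F) : fderiv ℝ (fun z : E × F => H z.1) z ζ = fderiv ℝ H z.1 ζ.1 := by
  have hd : HasFDerivAt (fun z : E × F => H z.1) _ z := hH.hasFDerivAt.comp z hasFDerivAt_fst
  rw [hd.fderiv]
  rfl

theorem IsSwitchingFunction.comp_fst {H : E → ℝ} (hH : IsSwitchingFunction H) :
    IsSwitchingFunction fun z : E × F => H z.1 := by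
  refine ⟨hH.1.comp contDiff_fst, fun z hz h0 => ?_⟩
  obtain ⟨n, hn⟩ := exists_apply_eq_one_of_ne_zero (hH.2 z.1 hz)
  have happly := fderiv_comp_fst_apply (F := F) (hH.1.differentiable one_ne_zero z.1) (n, 0)
  simp [h0, hn] at happly

variable {H : E → ℝ} {f g : E → F → E} {p₁ p₂ k₁ k₂ : ℝ}

theorem IsNorming.hasPiecewiseSlopeLE {w : E} {ψ : E →L[ℝ] ℝ} (hψ : IsNorming ψ w)
    (hH : IsSwitchingFunction H) (hf : Differentiable ℝ fun z : E × F => f z.1 z.2)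
    (hg : Differentiable ℝ fun z : E × F => g z.1 z.2)
    (hμf : ∀ x u, 0 ≤ H x → matrixMeasure (fderiv ℝ (fun z => f z u) x) ≤ -p₁)
    (hμg : ∀ x u, H x ≤ 0 → matrixMeasure (fderiv ℝ (fun z => g z u) x) ≤ -p₂)
    (hχ : ∀ x u, H x = 0 → matrixMeasure (jumpGrad H x (f x u - g x u)) ≤ 0)
    (hkf : ∀ x u, 0 ≤ H x → ‖fderiv ℝ (f x) u‖ ≤ k₁)
    (hkg : ∀ x u, H x ≤ 0 → ‖fderiv ℝ (g x) u‖ ≤ k₂) (v : F) :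
    HasPiecewiseSlopeLE (fun z : E × F => H z.1) (fun z => ψ (f z.1 z.2)) (fun z => ψ (g z.1 z.2))
      (w, v) (-min p₁ p₂ * ‖w‖ + max k₁ k₂ * ‖v‖) where
  switching := hH.comp_fst
  differentiable₁ := ψ.differentiable.comp hf
  differentiable₂ := ψ.differentiable.comp hg
  slope₁ z hz := (hψ.fderiv_comp_apply_le (hf z) (hμf z.1 z.2 hz) (hkf z.1 z.2 hz) v).trans
    (by gcongr; exacts [min_le_left _ _, le_max_left _ _])
  slope₂ z hz := (hψ.fderiv_comp_apply_le (hg z) (hμg z.1 z.2 hz) (hkg z.1 z.2 hz) v).trans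
    (by gcongr; exacts [min_le_right _ _, le_max_right _ _])
  jump z hz := by
    rw [fderiv_comp_fst_apply (hH.1.differentiable one_ne_zero _), ← map_sub]
    exact hψ.mul_apply_nonpos_of_matrixMeasure_jumpGrad_le (hχ z.1 z.2 hz)

theorem isDissipative_filippovSet
    (hH : IsSwitchingFunction H) (hf : Differentiable ℝ fun z : E × F => f z.1 z.2)
    (hg : Differentiable ℝ fun z : E × F => g z.1 z.2)
    (hμf : ∀ x u, 0 ≤ H x → matrixMeasure (fderiv ℝ (fun z => f z u) x) ≤ -p₁)
    (hμg : ∀ x u, H x ≤ 0 → matrixMeasure (fderiv ℝ (fun z => g z u) x) ≤ -p₂)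
    (hχ : ∀ x u, H x = 0 → matrixMeasure (jumpGrad H x (f x u - g x u)) ≤ 0)
    (hkf : ∀ x u, 0 ≤ H x → ‖fderiv ℝ (f x) u‖ ≤ k₁)
    (hkg : ∀ x u, H x ≤ 0 → ‖fderiv ℝ (g x) u‖ ≤ k₂) :
    IsDissipative (fun x u => filippovSet (H x) (f x u) (g x u)) (min p₁ p₂) (max k₁ k₂) := by
  intro x y u v
  obtain ⟨ψ, hψ, htan⟩ := exists_isNorming_apply_eq_zero_of_tangent (hH.2 x) (hχ x u) (x - y)
  refine ⟨ψ, hψ, fun a ha b hb => ?_⟩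
  have hslope := hψ.hasPiecewiseSlopeLE hH hf hg hμf hμg hχ hkf hkg (u - v)
  have hend : (y, v) + (x - y, u - v) = (x, u) := by simp
  rw [map_sub, sub_le_iff_le_add']
  refine hslope.le_add_of_mem_filippovSet (z := (y, v)) ?_ ?_ (map_mem_filippovSet hb ψ)
  · rw [hend, fderiv_comp_fst_apply (hH.1.differentiable one_ne_zero _)]
    exact fun hx hw => sub_eq_zero.1 ((map_sub ψ _ _).symm.trans (htan hx hw))
  · rw [hend]
    exact map_mem_filippovSet ha ψ

end SwitchedField

section SmallGain

theorem absolutelyContinuousOnInterval_of_dist_le {X Y : Type*} [PseudoMetricSpace X]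
    [PseudoMetricSpace Y] {f : ℝ → X} {g : ℝ → Y} {a b : ℝ}
    (hf : AbsolutelyContinuousOnInterval f a b) (h : ∀ s t, dist (g s) (g t) ≤ dist (f s) (f t)) :
    AbsolutelyContinuousOnInterval g a b :=
  squeeze_zero (fun _ => Finset.sum_nonneg fun _ _ => dist_nonneg)
    (fun _ => Finset.sum_le_sum fun _ _ => h _ _) hf

theorem le_of_ae_deriv_nonpos {g : ℝ → ℝ} {a b : ℝ} (hab : a ≤ b)
    (hg : AbsolutelyContinuousOnInterval g a b) (hd : ∀ᵐ t, t ∈ Icc a b → deriv g t ≤ 0) :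
    g b ≤ g a := by
  have hint : ∫ t in a..b, deriv g t ≤ 0 := by
    rw [intervalIntegral.integral_of_le hab]
    exact setIntegral_nonpos_ae measurableSet_Ioc
      (hd.mono fun t ht h => ht (Ioc_subset_Icc_self h))
  rwa [hg.integral_deriv_eq_sub, sub_nonpos] at hint

theorem le_exp_mul_of_ae_deriv_le {g : ℝ → ℝ} {a b c : ℝ} (hab : a ≤ b)
    (hg : AbsolutelyContinuousOnInterval g a b) (hd : ∀ᵐ t, t ∈ Icc a b → deriv g t ≤ -c * g t) :
    g b ≤ Real.exp (-c * (b - a)) * g a := by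
  have hexp (t : ℝ) :
      HasDerivAt (fun t => Real.exp (c * (t - a))) (Real.exp (c * (t - a)) * c) t := by
    simpa using (((hasDerivAt_id t).sub_const a).const_mul c).exp
  have hexpAC : AbsolutelyContinuousOnInterval (fun t => Real.exp (c * (t - a))) a b :=
    ContDiffOn.absolutelyContinuousOnInterval (by fun_prop)
  have hle := le_of_ae_deriv_nonpos hab (hexpAC.mul hg) <| by
    filter_upwards [hd, hg.ae_differentiableAt] with t hdt hgt ht
    have hderiv := (hexp t).mul (hgt (uIcc_of_le hab ▸ ht)).hasDerivAt
    rw [hderiv.deriv]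
    nlinarith [hdt ht, Real.exp_pos (c * (t - a))]
  simp only [Pi.mul_apply, sub_self, mul_zero, Real.exp_zero, one_mul] at hle
  rwa [neg_mul, Real.exp_neg, ← div_eq_inv_mul, le_div_iff₀' (Real.exp_pos _)]

theorem exists_smallGain_weight {p q k m : ℝ} (hq : 0 < q) (hk : 0 ≤ k)
    (hgain : k * m < p * q) : ∃ β > 0, ∃ c > 0, β * m + c ≤ p ∧ k + c * β ≤ β * q := by
  have hlim : Tendsto (fun β => β * m) (𝓝[>] (k / q)) (𝓝 (k / q * m)) :=
    (tendsto_id.mul_const _).mono_left nhdsWithin_le_nhds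
  have hlt : k / q * m < p := by rwa [div_mul_eq_mul_div, div_lt_iff₀ hq]
  obtain ⟨β, hβp, hβ⟩ := ((hlim.eventually_lt_const hlt).and self_mem_nhdsWithin).exists
  have hβ0 : 0 < β := (div_nonneg hk hq.le).trans_lt hβ
  have hkβ : k < β * q := (div_lt_iff₀ hq).1 hβ
  refine ⟨β, hβ0, min (p - β * m) ((β * q - k) / β),
    lt_min (sub_pos.2 hβp) (div_pos (sub_pos.2 hkβ) hβ0), ?_, ?_⟩
  · linarith [min_le_left (p - β * m) ((β * q - k) / β)]
  · linarith [(le_div_iff₀ hβ0).1 (min_le_right (p - β * m) ((β * q - k) / β))]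

theorem exists_smallGain_decay {p q k m : ℝ} (hq : 0 < q) (hk : 0 ≤ k)
    (hgain : k * m < p * q) :
    ∃ K > 0, ∃ c > 0, ∀ (a b : ℝ) (u v : ℝ → ℝ), a ≤ b → 0 ≤ u → 0 ≤ v →
      AbsolutelyContinuousOnInterval u a b → AbsolutelyContinuousOnInterval v a b →
      (∀ᵐ t, t ∈ Icc a b → deriv u t ≤ -p * u t + k * v t) →
      (∀ᵐ t, t ∈ Icc a b → deriv v t ≤ -q * v t + m * u t) →
      max (u b) (v b) ≤ K * Real.exp (-c * (b - a)) * max (u a) (v a) := by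
  obtain ⟨β, hβ, c, hc, hβp, hβq⟩ := exists_smallGain_weight hq hk hgain
  refine ⟨(1 + β⁻¹) * (1 + β), by positivity, c, hc, fun a b u v hab hu hv huAC hvAC hud hvd => ?_⟩
  have hdecay : u b + β * v b ≤ Real.exp (-c * (b - a)) * (u a + β * v a) := by
    refine le_exp_mul_of_ae_deriv_le (g := fun t => u t + β * v t) hab
      (huAC.add (hvAC.const_mul β)) ?_
    filter_upwards [hud, hvd, huAC.ae_differentiableAt, hvAC.ae_differentiableAt]
      with t hut hvt hu' hv' ht
    have ht' : t ∈ uIcc a b := uIcc_of_le hab ▸ ht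
    have hderiv : HasDerivAt (fun t => u t + β * v t) _ t :=
      (hu' ht').hasDerivAt.add ((hv' ht').hasDerivAt.const_mul β)
    rw [hderiv.deriv]
    linarith [hut ht, mul_le_mul_of_nonneg_left (hvt ht) hβ.le,
      mul_le_mul_of_nonneg_right hβp (hu t), mul_le_mul_of_nonneg_right hβq (hv t)]
  have hlower : max (u b) (v b) ≤ (1 + β⁻¹) * (u b + β * v b) := by
    have hub : 0 ≤ u b := hu b
    have hvb : 0 ≤ v b := hv b
    have hexpand : (1 + β⁻¹) * (u b + β * v b) = u b + v b + (β * v b + β⁻¹ * u b) := by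
      field_simp
      ring
    have : 0 ≤ β * v b + β⁻¹ * u b := by positivity
    exact max_le (by linarith) (by linarith)
  have hupper : u a + β * v a ≤ (1 + β) * max (u a) (v a) := by
    linarith [le_max_left (u a) (v a), mul_le_mul_of_nonneg_left (le_max_right (u a) (v a)) hβ.le]
  calc max (u b) (v b) ≤ (1 + β⁻¹) * (u b + β * v b) := hlower
    _ ≤ (1 + β⁻¹) * (Real.exp (-c * (b - a)) * ((1 + β) * max (u a) (v a))) := by
        gcongr
        exact hdecay.trans (by gcongr)
    _ = _ := by ring

variable {E₁ E₂ : Type*} [NormedAddCommGroup E₁] [NormedSpace ℝ E₁]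
  [NormedAddCommGroup E₂] [NormedSpace ℝ E₂]

theorem expIncrementallyStable_of_isDissipative {𝓕₁ : ℝ → E₁ → E₂ → Set E₁}
    {𝓕₂ : ℝ → E₂ → E₁ → Set E₂} {p q k m : ℝ} (hq : 0 < q) (hk : 0 ≤ k)
    (hgain : k * m < p * q) (h₁ : ∀ t, 0 ≤ t → IsDissipative (𝓕₁ t) p k)
    (h₂ : ∀ t, 0 ≤ t → IsDissipative (𝓕₂ t) q m) :
    ExpIncrementallyStable fun (t : ℝ) (ξ : E₁ × E₂) => 𝓕₁ t ξ.1 ξ.2 ×ˢ 𝓕₂ t ξ.2 ξ.1 := by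
  obtain ⟨K, hK, c, hc, hdecay⟩ := exists_smallGain_decay hq hk hgain
  refine ⟨K, hK, c, hc, fun t₀ t₁ ht₀ ht₁ x y hx hy t ht => ?_⟩
  have hsub : uIcc t₀ t ⊆ uIcc t₀ t₁ := by
    rw [uIcc_of_le ht.1, uIcc_of_le ht₁]
    exact Icc_subset_Icc_right ht.2
  have hAC := (hx.1.sub hy.1).mono hsub
  have hAC₁ : AbsolutelyContinuousOnInterval (fun s => ‖(x s).1 - (y s).1‖) t₀ t :=
    absolutelyContinuousOnInterval_of_dist_le hAC fun r s =>
      (dist_norm_norm_le _ _).trans <| by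
        rw [dist_eq_norm]
        exact norm_fst_le ((x r - y r) - (x s - y s))
  have hAC₂ : AbsolutelyContinuousOnInterval (fun s => ‖(x s).2 - (y s).2‖) t₀ t :=
    absolutelyContinuousOnInterval_of_dist_le hAC fun r s =>
      (dist_norm_norm_le _ _).trans <| by
        rw [dist_eq_norm]
        exact norm_snd_le ((x r - y r) - (x s - y s))
  have hx' := (ae_restrict_iff' measurableSet_Icc).1 hx.2
  have hy' := (ae_restrict_iff' measurableSet_Icc).1 hy.2
  refine hdecay t₀ t _ _ ht.1 (fun s => norm_nonneg _) (fun s => norm_nonneg _) hAC₁ hAC₂ ?_ ?_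
  · filter_upwards [hx', hy', hAC₁.ae_differentiableAt] with s hxs hys hn hs
    obtain ⟨a, ha, hxa⟩ := hxs ⟨hs.1, hs.2.trans ht.2⟩
    obtain ⟨b, hb, hyb⟩ := hys ⟨hs.1, hs.2.trans ht.2⟩
    exact (h₁ s (ht₀.trans hs.1)).deriv_norm_sub_le hxa.fst ha.1 hyb.fst hb.1
      (hn (uIcc_of_le ht.1 ▸ hs))
  · filter_upwards [hx', hy', hAC₂.ae_differentiableAt] with s hxs hys hn hs
    obtain ⟨a, ha, hxa⟩ := hxs ⟨hs.1, hs.2.trans ht.2⟩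
    obtain ⟨b, hb, hyb⟩ := hys ⟨hs.1, hs.2.trans ht.2⟩
    exact (h₂ s (ht₀.trans hs.1)).deriv_norm_sub_le hxa.snd ha.2 hyb.snd hb.2
      (hn (uIcc_of_le ht.1 ▸ hs))

end SmallGain

section SmallGainTheorem

variable {E₁ E₂ : Type*} [NormedAddCommGroup E₁] [NormedSpace ℝ E₁]
  [NormedAddCommGroup E₂] [NormedSpace ℝ E₂]

theorem IsSmoothMode.differentiable {E : Type*} [NormedAddCommGroup E] [NormedSpace ℝ E]
    {f : E₁ → E₂ → ℝ → E} (hf : IsSmoothMode f) (t : ℝ) (ht : 0 ≤ t) :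
    Differentiable ℝ fun ξ : E₁ × E₂ => f ξ.1 ξ.2 t :=
  (hf t ht).differentiable one_ne_zero

theorem theorem1_general (H₁ : E₁ → ℝ) (H₂ : E₂ → ℝ)
    (f₁₁ f₁₂ : E₁ → E₂ → ℝ → E₁) (f₂₁ f₂₂ : E₁ → E₂ → ℝ → E₂)
    (hH₁ : IsSwitchingFunction H₁) (hH₂ : IsSwitchingFunction H₂)
    (hf₁₁ : ∀ t, 0 ≤ t → Differentiable ℝ fun ξ : E₁ × E₂ => f₁₁ ξ.1 ξ.2 t)
    (hf₁₂ : ∀ t, 0 ≤ t → Differentiable ℝ fun ξ : E₁ × E₂ => f₁₂ ξ.1 ξ.2 t)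
    (hf₂₁ : ∀ t, 0 ≤ t → Differentiable ℝ fun ξ : E₁ × E₂ => f₂₁ ξ.1 ξ.2 t)
    (hf₂₂ : ∀ t, 0 ≤ t → Differentiable ℝ fun ξ : E₁ × E₂ => f₂₂ ξ.1 ξ.2 t)
    (p₁ p₂ q₁ q₂ k₁ k₂ m₁ m₂ : ℝ)
    (hp₁ : 0 < p₁) (hp₂ : 0 < p₂) (hq₁ : 0 < q₁) (hq₂ : 0 < q₂)
    (hμ₁₁ : ∀ ξ₁ ξ₂ t, 0 ≤ t → 0 ≤ H₁ ξ₁ → matrixMeasure (jac₁ f₁₁ ξ₁ ξ₂ t) ≤ -p₁)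
    (hμ₁₂ : ∀ ξ₁ ξ₂ t, 0 ≤ t → H₁ ξ₁ ≤ 0 → matrixMeasure (jac₁ f₁₂ ξ₁ ξ₂ t) ≤ -p₂)
    (hμ₂₁ : ∀ ξ₁ ξ₂ t, 0 ≤ t → 0 ≤ H₂ ξ₂ → matrixMeasure (jac₂ f₂₁ ξ₁ ξ₂ t) ≤ -q₁)
    (hμ₂₂ : ∀ ξ₁ ξ₂ t, 0 ≤ t → H₂ ξ₂ ≤ 0 → matrixMeasure (jac₂ f₂₂ ξ₁ ξ₂ t) ≤ -q₂)
    (hχ₁ : ∀ ξ₁ ξ₂ t, 0 ≤ t → H₁ ξ₁ = 0 →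
      matrixMeasure (jumpGrad H₁ ξ₁ (f₁₁ ξ₁ ξ₂ t - f₁₂ ξ₁ ξ₂ t)) ≤ 0)
    (hχ₂ : ∀ ξ₁ ξ₂ t, 0 ≤ t → H₂ ξ₂ = 0 →
      matrixMeasure (jumpGrad H₂ ξ₂ (f₂₁ ξ₁ ξ₂ t - f₂₂ ξ₁ ξ₂ t)) ≤ 0)
    (hk₁₁ : ∀ ξ₁ ξ₂ t, 0 ≤ t → 0 ≤ H₁ ξ₁ → ‖jac₂ f₁₁ ξ₁ ξ₂ t‖ ≤ k₁)
    (hk₁₂ : ∀ ξ₁ ξ₂ t, 0 ≤ t → H₁ ξ₁ ≤ 0 → ‖jac₂ f₁₂ ξ₁ ξ₂ t‖ ≤ k₂)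
    (hm₂₁ : ∀ ξ₁ ξ₂ t, 0 ≤ t → 0 ≤ H₂ ξ₂ → ‖jac₁ f₂₁ ξ₁ ξ₂ t‖ ≤ m₁)
    (hm₂₂ : ∀ ξ₁ ξ₂ t, 0 ≤ t → H₂ ξ₂ ≤ 0 → ‖jac₁ f₂₂ ξ₁ ξ₂ t‖ ≤ m₂)
    (hgain : max k₁ k₂ * max m₁ m₂ / (min p₁ p₂ * min q₁ q₂) < 1) :
    ExpIncrementallyStable (feedbackInclusion H₁ H₂ f₁₁ f₁₂ f₂₁ f₂₂) := by
  have hp : 0 < min p₁ p₂ := lt_min hp₁ hp₂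
  have hq : 0 < min q₁ q₂ := lt_min hq₁ hq₂
  have hk : 0 ≤ max k₁ k₂ := le_max_iff.2 <| (le_total 0 (H₁ 0)).imp
    (fun h => (norm_nonneg _).trans (hk₁₁ 0 0 0 le_rfl h))
    (fun h => (norm_nonneg _).trans (hk₁₂ 0 0 0 le_rfl h))
  have hswap : Differentiable ℝ (Prod.swap : E₂ × E₁ → E₁ × E₂) :=
    differentiable_snd.prodMk differentiable_fst
  refine expIncrementallyStable_of_isDissipative hq hk ((div_lt_one (mul_pos hp hq)).1 hgain)
    (𝓕₁ := fun t x u => filippovSet (H₁ x) (f₁₁ x u t) (f₁₂ x u t))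
    (𝓕₂ := fun t x u => filippovSet (H₂ x) (f₂₁ u x t) (f₂₂ u x t))
    (fun t ht => ?_) (fun t ht => ?_)
  · exact isDissipative_filippovSet hH₁ (hf₁₁ t ht) (hf₁₂ t ht)
      (fun x u => hμ₁₁ x u t ht) (fun x u => hμ₁₂ x u t ht) (fun x u => hχ₁ x u t ht)
      (fun x u => hk₁₁ x u t ht) (fun x u => hk₁₂ x u t ht)
  · exact isDissipative_filippovSet hH₂ ((hf₂₁ t ht).comp hswap) ((hf₂₂ t ht).comp hswap)
      (fun x u => hμ₂₁ u x t ht) (fun x u => hμ₂₂ u x t ht) (fun x u => hχ₂ u x t ht)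
      (fun x u => hm₂₁ u x t ht) (fun x u => hm₂₂ u x t ht)

end SmallGainTheorem

theorem theorem1
    {E₁ E₂ : Type*}
    [NormedAddCommGroup E₁] [NormedSpace ℝ E₁] [FiniteDimensional ℝ E₁]
    [NormedAddCommGroup E₂] [NormedSpace ℝ E₂] [FiniteDimensional ℝ E₂]
    (H₁ : E₁ → ℝ) (H₂ : E₂ → ℝ)
    (f₁₁ f₁₂ : E₁ → E₂ → ℝ → E₁) (f₂₁ f₂₂ : E₁ → E₂ → ℝ → E₂)
    (hH₁ : IsSwitchingFunction H₁) (hH₂ : IsSwitchingFunction H₂)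
    (hf₁₁ : IsSmoothMode f₁₁) (hf₁₂ : IsSmoothMode f₁₂)
    (hf₂₁ : IsSmoothMode f₂₁) (hf₂₂ : IsSmoothMode f₂₂)
    (p₁ p₂ q₁ q₂ k₁ k₂ m₁ m₂ : ℝ)
    (hp₁ : 0 < p₁) (hp₂ : 0 < p₂) (hq₁ : 0 < q₁) (hq₂ : 0 < q₂)
    (hk₁ : 0 < k₁) (hk₂ : 0 < k₂) (hm₁ : 0 < m₁) (hm₂ : 0 < m₂)
    -- each mode is contracting in its own state, on its own closed region
    (hμ₁₁ : ∀ ξ₁ ξ₂ t, 0 ≤ t → 0 ≤ H₁ ξ₁ → matrixMeasure (jac₁ f₁₁ ξ₁ ξ₂ t) ≤ -p₁)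
    (hμ₁₂ : ∀ ξ₁ ξ₂ t, 0 ≤ t → H₁ ξ₁ ≤ 0 → matrixMeasure (jac₁ f₁₂ ξ₁ ξ₂ t) ≤ -p₂)
    (hμ₂₁ : ∀ ξ₁ ξ₂ t, 0 ≤ t → 0 ≤ H₂ ξ₂ → matrixMeasure (jac₂ f₂₁ ξ₁ ξ₂ t) ≤ -q₁)
    (hμ₂₂ : ∀ ξ₁ ξ₂ t, 0 ≤ t → H₂ ξ₂ ≤ 0 → matrixMeasure (jac₂ f₂₂ ξ₁ ξ₂ t) ≤ -q₂)
    -- the switching terms have zero matrix measure on the switching surfaces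
    (hχ₁ : ∀ ξ₁ ξ₂ t, 0 ≤ t → H₁ ξ₁ = 0 →
      matrixMeasure (jumpGrad H₁ ξ₁ (f₁₁ ξ₁ ξ₂ t - f₁₂ ξ₁ ξ₂ t)) = 0)
    (hχ₂ : ∀ ξ₁ ξ₂ t, 0 ≤ t → H₂ ξ₂ = 0 →
      matrixMeasure (jumpGrad H₂ ξ₂ (f₂₁ ξ₁ ξ₂ t - f₂₂ ξ₁ ξ₂ t)) = 0)
    -- the interconnection Jacobians are bounded
    (hk₁₁ : ∀ ξ₁ ξ₂ t, 0 ≤ t → 0 ≤ H₁ ξ₁ → ‖jac₂ f₁₁ ξ₁ ξ₂ t‖ ≤ k₁)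
    (hk₁₂ : ∀ ξ₁ ξ₂ t, 0 ≤ t → H₁ ξ₁ ≤ 0 → ‖jac₂ f₁₂ ξ₁ ξ₂ t‖ ≤ k₂)
    (hm₂₁ : ∀ ξ₁ ξ₂ t, 0 ≤ t → 0 ≤ H₂ ξ₂ → ‖jac₁ f₂₁ ξ₁ ξ₂ t‖ ≤ m₁)
    (hm₂₂ : ∀ ξ₁ ξ₂ t, 0 ≤ t → H₂ ξ₂ ≤ 0 → ‖jac₁ f₂₂ ξ₁ ξ₂ t‖ ≤ m₂)
    -- small-gain condition
    (hgain : max k₁ k₂ * max m₁ m₂ / (min p₁ p₂ * min q₁ q₂) < 1) :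
    ExpIncrementallyStable (feedbackInclusion H₁ H₂ f₁₁ f₁₂ f₂₁ f₂₂) := by
  exact theorem1_general H₁ H₂ f₁₁ f₁₂ f₂₁ f₂₂ hH₁ hH₂
    hf₁₁.differentiable hf₁₂.differentiable hf₂₁.differentiable hf₂₂.differentiable
    p₁ p₂ q₁ q₂ k₁ k₂ m₁ m₂ hp₁ hp₂ hq₁ hq₂ hμ₁₁ hμ₁₂ hμ₂₁ hμ₂₂
    (fun ξ₁ ξ₂ t ht h => (hχ₁ ξ₁ ξ₂ t ht h).le) (fun ξ₁ ξ₂ t ht h => (hχ₂ ξ₁ ξ₂ t ht h).le)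
    hk₁₁ hk₁₂ hm₂₁ hm₂₂ hgain
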